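/- **Setting.** Strings are finite words over a linearly ordered alphabet, ordered lexicographically; a string $s$ with letters $s[0],\dots,s[\ell-1]$ is followed by a terminator $s[\ell]=0$ that is smaller than every letter. The sentinel string $\infty$ consists of the character $\infty$, larger than all others. $\mathrm{lcp}(s,t)$ is the length of the longest common prefix of $s,t$ (terminators excluded), and $\mathrm{lcp}(s,\infty)=0$. An LCP array of a sequence $[s_1,\dots,s_n]$ is $H=[\bot,h_2,\dots,h_n]$ with $h_i=\mathrm{lcp}(s_{i-1},s_i)$ (the first entry is arbitrary), and $L(H)=\sum_{i=2}^n h_i$. **LCP-Compare** of $(a,h_a)$ and $(b,h_b)$, where $a,b$ are input indices with current strings $s_a,s_b$, returns (winner; loser). If $h_a=h_b$: put $h'=h_a$; while $s_a[h']\notin\{0,\infty\}$ and $s_a[h']=s_b[h']$, increment $h'$; then return $(a,h_a;b,h')$ if $s_a[h']\le s_b[h']$, and $(b,h_b;a,h')$ otherwise. If $h_a<h_b$: return $(b,h_b;a,h_a)$. If $h_a>h_b$: return $(a,h_a;b,h_b)$. Every evaluation of the loop condition counts as one (ternary) character comparison, which also covers the final test $s_a[h']\le s_b[h']$. There are no other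 character comparisons. **$K$-way LCP-merge.** Let $K\ge 1$ be a power of two. The input is $K$ sorted sequences of strings $\mathcal S_1,\dots,\mathcal S_K$ (possibly empty, repetitions allowed) with LCP arrays $H_1,\dots,H_K$, and the length $\bar h$ of some common prefix of all the strings. Each sequence is followed by the sentinel $\infty$, with LCP entry $0$. The tournament (loser) tree has nodes $1,\dots,K$ with entries (input index, LCP value): node $1$ holds the overall winner, node $i\ge 2$ the loser of its game. Node $i>1$ has parent $\lceil i/2\rceil$, and input $k$ is the leaf $K+k$. The current string $s_k$ is first the first element of $\mathcal S_k$ (or $\infty$). *Building:* for $k=1,\dots,K$: set $x=(k,\bar h)$ and $v=K+k$. While $v$ is even and $v>2$, set $v:=v/2$, play LCP-Compare of $x$ with the entry of node $v$, let $x$ be the winner and store the loser in node $v$. Then store $x$ in node $\lceil v/2\rceil$. *Merging:* for $\sum_k|\mathcal S_k|$ rounds: let $(w,h)$ be the entry of node $1$. Append $s_w$ to the output $\mathcal S_0$ and $h$ to $H_0$, and advance input $w$ to its next item. Set $x=(w,h'')$, where $h''$ is the LCP entry of the new item, and $v=K+w$. While $v>2$, set $v:=\lceil v/2\rceil$, play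 LCP-Compare of $x$ with the entry of node $v$, let $x$ be the winner and store the loser in node $v$. Then store $x$ in node $1$. **Theorem.** The output $\mathcal S_0$ is the sorted sequence of all strings of $\mathcal S_1,\dots,\mathcal S_K$ (with multiplicity), $H_0$ is an LCP array of $\mathcal S_0$, and the whole execution makes at most $$\Delta L+n\log_2K+K$$ character comparisons, where $n=|\mathcal S_0|$ and $\Delta L=L(H_0)-\sum_{k=1}^K L(H_k)$. -/

import Mathlib

namespace KWayLCP

variable {α : Type*} [LinearOrder α]

/-- Length of the longest common prefix of two strings (terminators not included). -/
def lcp : List α → List α → ℕ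
  | a :: s, b :: t => if a = b then lcp s t + 1 else 0
  | _, _ => 0

/-- `H` is the LCP array of the sequence `T`: apart from its first entry, which is arbitrary,
the entries of `H` are the LCP lengths of consecutive strings of `T`. -/
def IsLCPArray (T : List (List α)) (H : List ℕ) : Prop :=
  H.length = T.length ∧
    ∀ (i : ℕ) (hT : i + 1 < T.length) (hH : i + 1 < H.length), H[i + 1] = lcp T[i] T[i + 1]

/-- `L(H)`, the sum of all entries of an LCP array except the first. -/
def lcpSum (H : List ℕ) : ℕ := H.tail.sum

/-- The character with zero-based index `i` of a string or of the sentinel string `⊤`.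
The character values are `0 < letters < ∞`: here `0`, the terminator that follows the last letter,
is `⊥`, and `∞`, the only character of the sentinel string, is `⊤`. -/
def charAt {α : Type*} : WithTop (List α) → ℕ → WithTop (WithBot α)
  | none, _ => ⊤
  | some s, i =>
    match s[i]? with
    | some c => ((c : WithBot α) : WithTop (WithBot α))
    | none => ((⊥ : WithBot α) : WithTop (WithBot α))

/-- Number of letters of a string, `0` for the sentinel (used only to show termination). -/
def strLen {α : Type*} : WithTop (List α) → ℕ
  | none => 0
  | some s => s.length

theorem lt_strLen {α : Type*} (s : WithTop (List α)) (i : ℕ)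
    (h0 : charAt s i ≠ ((⊥ : WithBot α) : WithTop (WithBot α))) (hi : charAt s i ≠ ⊤) :
    i < strLen s := by
  cases s with
  | top => exact absurd rfl hi
  | coe s =>
    by_contra hlt
    apply h0
    have hle : s.length ≤ i := not_lt.mp hlt
    change (match s[i]? with
      | some c => ((c : WithBot α) : WithTop (WithBot α))
      | none => ((⊥ : WithBot α) : WithTop (WithBot α))) = _
    rw [List.getElem?_eq_none hle]

/-- The character comparison loop, started at index `h`: while both strings have the same letter
at index `h`, increment `h`. Returns the final index and the number of character comparisons made;
every evaluation of the loop condition is one (ternary) character comparison. -/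
def charLoop (sa sb : WithTop (List α)) (h : ℕ) : ℕ × ℕ :=
  if hc : charAt sa h ≠ ((⊥ : WithBot α) : WithTop (WithBot α)) ∧ charAt sa h ≠ ⊤ ∧
      charAt sa h = charAt sb h then
    let r := charLoop sa sb (h + 1)
    (r.1, r.2 + 1)
  else (h, 1)
termination_by strLen sa - h
decreasing_by
  have := lt_strLen sa h hc.1 hc.2.1
  omega

/-- A player: the index of an input sequence, and an LCP value. -/
abbrev Player (K : ℕ) := Fin K × ℕ

/-- The result of one game. -/
structure Game (K : ℕ) where
  winner : Player K
  loser : Player K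
  /-- number of character comparisons made -/
  cost : ℕ

/-- `LCP-Compare` of the players `a` and `b`, whose strings are `s a.1` and `s b.1`. -/
def lcpCompare {K : ℕ} (s : Fin K → WithTop (List α)) (a b : Player K) : Game K :=
  if a.2 = b.2 then
    let r := charLoop (s a.1) (s b.1) a.2
    if charAt (s a.1) r.1 ≤ charAt (s b.1) r.1 then ⟨a, (b.1, r.1), r.2⟩
    else ⟨b, (a.1, r.1), r.2⟩
  else if a.2 < b.2 then ⟨b, a, 0⟩
  else ⟨a, b, 0⟩

/-- The tournament tree: node `1` holds the overall winner, nodes `2, …, K` the losers of the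
games. Node `i > 1` has parent `⌈i / 2⌉`, and `K + 1, …, 2 K` are the input leaves. -/
abbrev Tree (K : ℕ) := ℕ → Player K

/-- Play while the current node `v` is even (and not the topmost game `2`) when building the tree,
then store the intermediate winner in the parent of the node that was reached.
Returns the new tree and the updated comparison counter. -/
def buildPath {K : ℕ} (s : Fin K → WithTop (List α)) (v : ℕ) (p : Player K) (t : Tree K) (c : ℕ) :
    Tree K × ℕ :=
  if _h : v % 2 = 0 ∧ 2 < v then
    let g := lcpCompare s p (t (v / 2))
    buildPath s (v / 2) g.winner (Function.update t (v / 2) g.loser) (c + g.cost)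
  else (Function.update t ((v + 1) / 2) p, c)
termination_by v
decreasing_by omega

/-- Replay all games from node `v` up to the root and store the winner in node `1`.
Returns the new tree and the updated comparison counter. -/
def replayPath {K : ℕ} (s : Fin K → WithTop (List α)) (v : ℕ) (p : Player K) (t : Tree K) (c : ℕ) :
    Tree K × ℕ :=
  if _h : 2 < v then
    let g := lcpCompare s p (t ((v + 1) / 2))
    replayPath s ((v + 1) / 2) g.winner (Function.update t ((v + 1) / 2) g.loser) (c + g.cost)
  else (Function.update t 1 p, c)
termination_by v
decreasing_by omega

/-- The current string of each input, where `i k` is the zero-based index of the front item of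
input `k`; past the end of a sequence this is the sentinel `⊤`. -/
def front {α : Type*} {K : ℕ} (S : Fin K → List (List α)) (i : Fin K → ℕ) (k : Fin K) : WithTop (List α) :=
  ((S k)[i k]? : Option (List α))

/-- The state of the merge: front indexes, tree, output strings, output LCP array, and the number of
character comparisons made so far. -/
structure State (α : Type*) (K : ℕ) where
  idx : Fin K → ℕ
  tree : Tree K
  outS : List (WithTop (List α))
  outH : List ℕ
  cmps : ℕ

/-- Building the tree: the inputs enter from left to right, each with LCP value `hbar`.
The initial content of the tree is never read. -/
def build {K : ℕ} [NeZero K] (S : Fin K → List (List α)) (hbar : ℕ) : State α K :=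
  let r := (List.finRange K).foldl
    (fun (r : Tree K × ℕ) k =>
      buildPath (front S fun _ => 0) (K + (k.val + 1)) (k, hbar) r.1 r.2)
    ((fun _ => (0, 0)), 0)
  ⟨fun _ => 0, r.1, [], [], r.2⟩

/-- One round of the main loop: output the winner, advance its input (the sentinel has LCP value
`0`), and replay the games on its path. -/
def step {K : ℕ} (S : Fin K → List (List α)) (H : Fin K → List ℕ) (st : State α K) : State α K :=
  let w := (st.tree 1).1
  let idx := Function.update st.idx w (st.idx w + 1)
  let r := replayPath (front S idx) (K + (w.val + 1)) (w, (H w).getD (idx w) 0) st.tree st.cmps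
  ⟨idx, r.1, st.outS ++ [front S st.idx w], st.outH ++ [(st.tree 1).2], r.2⟩

/-- `K`-way LCP-merge of the sequences `S k` with LCP arrays `H k`, where all strings have a
common prefix of length `hbar`. -/
def kwayMerge {K : ℕ} [NeZero K] (S : Fin K → List (List α)) (H : Fin K → List ℕ) (hbar : ℕ) :
    State α K :=
  (step S H)^[∑ k, (S k).length] (build S hbar)

end KWayLCP

/-!
Why the merge is correct and cheap: every LCP value in the tournament tree refers to a string known
to be no larger than the player's own string, its reference string, and it is the LCP length of the
two (`Follows`); the values of sentinels mean nothing, but are small. A loser has the winner of its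
game as reference string; both players of a game that is about to be played have the same reference
string, namely the string output last, or the common prefix of all inputs while the tree is built.
For players with a common reference string, distinct LCP values already decide the game, and equal
ones are a lower bound for the LCP length of the two players, from which the character loop
continues (`lcpCompare_spec`). After an output, the losers on the path of the overall winner have
lost to it, so their reference string is the string just output, and the advanced input has the same
reference string by its own LCP array (`replayPath_of_subtree`). So the games on this path can be
replayed, and the LCP value of the new overall winner refers to the string just output: this is the
next entry of the output LCP array.

For the cost, let the weight of the tree be the sum of the LCP values of all players in it,
sentinels excluded. A game makes at most one character comparison that does not increase the weight
of its players. There are `K - 1` games while building and `log₂ K` games in each round, and the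
increases add up to what has left the tree with the output minus what has entered it with the inputs
(`Invariant.balance`). Sentinels have to be excluded because the input of an empty sequence enters
with the length of the common prefix, and keeps it; it is harmless, as a sentinel can never beat a
string with such a value.
-/

namespace KWayLCP

variable {α : Type*} [LinearOrder α]

/-! ### Longest common prefixes and the lexicographic order -/

theorem lcp_comm (s t : List α) : lcp s t = lcp t s := by
  induction s generalizing t with
  | nil => cases t <;> simp [lcp]
  | cons a s ih => cases t with
    | nil => simp [lcp]
    | cons b t => simp only [lcp, ih t, eq_comm]

theorem lcp_of_prefix {p s : List α} (h : p <+: s) : lcp p s = p.length := by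
  obtain ⟨r, rfl⟩ := h
  induction p with
  | nil => simp [lcp]
  | cons a p ih => simp [lcp, ih]

theorem cons_le_cons_iff_lex {a b : α} {s t : List α} :
    a :: s ≤ b :: t ↔ a < b ∨ a = b ∧ s ≤ t := by
  simp only [le_iff_lt_or_eq, List.cons_lt_cons_iff, List.cons.injEq]
  tauto

theorem nil_le_list (s : List α) : [] ≤ s := by
  cases s with
  | nil => exact le_rfl
  | cons a s => exact (List.nil_lt_cons a s).le

theorem le_of_prefix {p s : List α} (h : p <+: s) : p ≤ s := by
  obtain ⟨r, rfl⟩ := h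
  induction p with
  | nil => exact nil_le_list _
  | cons a p ih => exact cons_le_cons_iff_lex.2 (Or.inr ⟨rfl, ih⟩)

/-- `lcp` satisfies the ultrametric inequality. -/
theorem min_lcp_le (z s t : List α) : min (lcp z s) (lcp z t) ≤ lcp s t := by
  induction z generalizing s t with
  | nil => simp [lcp]
  | cons c z ih =>
    cases s with
    | nil => simp [lcp]
    | cons a s => cases t with
      | nil => simp [lcp]
      | cons b t =>
        have := ih s t
        simp only [lcp]
        split_ifs <;> simp_all

theorem length_le_lcp {p s t : List α} (hs : p <+: s) (ht : p <+: t) : p.length ≤ lcp s t := by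
  simpa [lcp_of_prefix hs, lcp_of_prefix ht] using min_lcp_le p s t

/-- The string that leaves `z ≤ s` first is the larger one, because at that position `s` has a
larger character than `z`, while `t` still agrees with `z`. This decides a game with distinct LCP values
without any character comparison, and the loser keeps its LCP value. -/
theorem le_and_lcp_of_lcp_lt {z s t : List α} (hz : z ≤ s) (h : lcp z s < lcp z t) :
    t ≤ s ∧ lcp t s = lcp z s := by
  induction z generalizing s t with
  | nil => simp [lcp] at h
  | cons c z ih =>
    cases s with
    | nil => exact absurd hz (not_le.2 (List.nil_lt_cons c z))
    | cons a s => cases t with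
      | nil => simp [lcp] at h
      | cons b t =>
        rw [cons_le_cons_iff_lex] at hz
        simp only [lcp] at h ⊢
        rw [cons_le_cons_iff_lex]
        split_ifs at h ⊢ <;> simp_all

theorem lt_lcp_iff {s t : List α} {i : ℕ} (h : i ≤ lcp s t) :
    i < lcp s t ↔ ∃ c, s[i]? = some c ∧ t[i]? = some c := by
  induction s generalizing t i with
  | nil => simp [lcp]
  | cons a s ih => cases t with
    | nil => simp [lcp]
    | cons b t =>
      simp only [lcp] at h ⊢
      split_ifs at h ⊢ with hab
      · cases i with
        | zero => simp [hab]
        | succ i => simpa using ih (Nat.le_of_succ_le_succ h)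
      · obtain rfl : i = 0 := by omega
        simp only [lt_irrefl, List.length_cons, Nat.zero_lt_succ, getElem?_pos,
          List.getElem_cons_zero, Option.some.injEq, false_iff, not_exists, not_and]
        rintro c rfl rfl
        exact hab rfl

/-! ### Characters and the comparison loop -/

theorem charAt_coe {α : Type*} (s : List α) (i : ℕ) :
    charAt (s : WithTop (List α)) i =
    ((s[i]?.elim ⊥ fun c => (c : WithBot α) : WithBot α) : WithTop (WithBot α)) := by
  change (match s[i]? with
      | some c => ((c : WithBot α) : WithTop (WithBot α))
      | none => ((⊥ : WithBot α) : WithTop (WithBot α))) = _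
  cases s[i]? <;> rfl

theorem charAt_top {α : Type*} (i : ℕ) : charAt (⊤ : WithTop (List α)) i = ⊤ := rfl

theorem charAt_nil {α : Type*} (i : ℕ) :
    charAt (([] : List α) : WithTop (List α)) i = ((⊥ : WithBot α) : WithTop (WithBot α)) := rfl

theorem charAt_cons_zero {α : Type*} (a : α) (s : List α) :
    charAt ((a :: s : List α) : WithTop (List α)) 0 = ((a : WithBot α) : WithTop (WithBot α)) := rfl

theorem charAt_cons_succ {α : Type*} (a : α) (s : List α) (i : ℕ) :
    charAt ((a :: s : List α) : WithTop (List α)) (i + 1) = charAt (s : WithTop (List α)) i := rfl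

/-- The terminator, being smaller than all letters, makes the comparison right even if one of the
strings is a prefix of the other. -/
theorem charAt_lcp_le_iff (s t : List α) :
    charAt (s : WithTop (List α)) (lcp s t) ≤ charAt (t : WithTop (List α)) (lcp s t) ↔ s ≤ t := by
  induction s generalizing t with
  | nil =>
    rw [charAt_nil, charAt_coe, WithTop.coe_le_coe]
    exact iff_of_true bot_le (nil_le_list t)
  | cons a s ih => cases t with
    | nil =>
      refine iff_of_false ?_ (not_le.2 (List.nil_lt_cons a s))
      rw [lcp.eq_2 _ _ (by simp), charAt_cons_zero, charAt_nil, WithTop.coe_le_coe, not_le]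
      exact WithBot.bot_lt_coe a
    | cons b t =>
      rw [cons_le_cons_iff_lex]
      by_cases hab : a = b
      · simp [lcp, hab, charAt_cons_succ, ih t]
      · simp [lcp, hab, charAt_cons_zero, le_iff_lt_or_eq]

theorem charLoop_of_eq_top {s t : WithTop (List α)} (h : s = ⊤ ∨ t = ⊤) (i : ℕ) :
    charLoop s t i = (i, 1) := by
  rw [charLoop, dif_neg]
  rintro ⟨_, h2, h3⟩
  rcases h with rfl | rfl
  · exact h2 rfl
  · exact h2 h3

theorem charLoop_coe (s t : List α) (i : ℕ) (h : i ≤ lcp s t) :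
    charLoop (s : WithTop (List α)) (t : WithTop (List α)) i = (lcp s t, lcp s t - i + 1) := by
  have key : (charAt (s : WithTop (List α)) i ≠ ((⊥ : WithBot α) : WithTop (WithBot α)) ∧
      charAt (s : WithTop (List α)) i ≠ ⊤ ∧
      charAt (s : WithTop (List α)) i = charAt (t : WithTop (List α)) i) ↔ i < lcp s t := by
    rw [lt_lcp_iff h]
    rw [charAt_coe, charAt_coe, Ne, WithTop.coe_inj, WithTop.coe_inj]
    rcases s[i]? with _ | c <;> rcases t[i]? with _ | d <;> simp [eq_comm]
  rw [charLoop]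
  by_cases hi : i < lcp s t
  · rw [dif_pos (key.2 hi), charLoop_coe s t (i + 1) hi]
    ext <;> simp
    omega
  · rw [dif_neg (mt key.1 hi)]
    ext <;> simp <;> omega
termination_by lcp s t - i

/-! ### A single game -/

/-- `Follows b x y h`: in the role of an LCP value, `h` is correct for a player with current string
`y` whose reference string is `x`. For a genuine string `y` this means that `x` is a string which
does not exceed `y`, and `h` is their LCP length. The value carried by a sentinel means nothing,
but must not exceed the length `b` of the common prefix of all strings, so that a sentinel never
beats a genuine string. -/
def Follows (b : ℕ) (x : WithTop (List α)) (y : WithTop (List α)) (h : ℕ) : Prop :=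
  (y = ⊤ → h ≤ b) ∧ ∀ t : List α, y = t → ∃ z : List α, x = z ∧ z ≤ t ∧ h = lcp z t

/-- The LCP value of a player as it counts for the potential: that of a sentinel is ignored. -/
def weight {K : ℕ} (s : Fin K → WithTop (List α)) (a : Player K) : ℕ :=
  if s a.1 = ⊤ then 0 else a.2

theorem follows_top {b h : ℕ} {x : WithTop (List α)} (hb : h ≤ b) : Follows b x ⊤ h :=
  ⟨fun _ => hb, fun _ h => absurd h.symm (WithTop.coe_ne_top)⟩

theorem follows_coe {b h : ℕ} {z t : List α} :
    Follows b (z : WithTop (List α)) (t : WithTop (List α)) h ↔ z ≤ t ∧ h = lcp z t := by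
  constructor
  · rintro ⟨-, h2⟩
    obtain ⟨z', h3, h4⟩ := h2 t rfl
    rwa [WithTop.coe_inj.1 h3]
  · intro h2
    refine ⟨fun h => absurd h WithTop.coe_ne_top, fun t' ht => ⟨z, rfl, ?_⟩⟩
    rwa [← WithTop.coe_inj.1 ht]

theorem Follows.le {b h : ℕ} {x y : WithTop (List α)} (hf : Follows b x y h) : x ≤ y := by
  cases y with
  | top => exact le_top
  | coe t =>
    obtain ⟨z, rfl, hz, -⟩ := hf.2 t rfl
    exact WithTop.coe_le_coe.2 hz

theorem lcpCompare_of_lt {K : ℕ} (s : Fin K → WithTop (List α)) {a b : Player K}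
    (h : a.2 < b.2) : lcpCompare s a b = ⟨b, a, 0⟩ := by
  rw [lcpCompare, if_neg h.ne, if_pos h]

theorem lcpCompare_of_gt {K : ℕ} (s : Fin K → WithTop (List α)) {a b : Player K}
    (h : b.2 < a.2) : lcpCompare s a b = ⟨a, b, 0⟩ := by
  rw [lcpCompare, if_neg h.ne', if_neg h.not_gt]

/-- One game between two players with the same reference string `z`. The winner is unchanged, the
loser gets the LCP value for the winner as its new reference string, and all character comparisons
except possibly the last one are paid for by an increase of the total weight. -/
theorem lcpCompare_spec {K : ℕ} {s : Fin K → WithTop (List α)} {p z : List α} {a b : Player K}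
    (hs : ∀ k (t : List α), s k = t → p <+: t) (hz : p <+: z)
    (ha : Follows p.length z (s a.1) a.2) (hb : Follows p.length z (s b.1) b.2) :
    let g := lcpCompare s a b
    (g.winner = a ∧ g.loser.1 = b.1 ∨ g.winner = b ∧ g.loser.1 = a.1) ∧
      Follows p.length (s g.winner.1) (s g.loser.1) g.loser.2 ∧
      g.cost + weight s a + weight s b ≤ weight s g.winner + weight s g.loser + 1 := by
  obtain ⟨i, m⟩ := a
  obtain ⟨j, n⟩ := b
  simp only at ha hb
  have hsi := hs i
  have hsj := hs j
  rcases lt_trichotomy m n with hmn | rfl | hmn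
  -- The smaller value `m` cannot belong to a string facing a sentinel: its value is at least
  -- `p.length`, and that of a sentinel is at most `p.length`.
  · rw [lcpCompare_of_lt _ hmn]
    refine ⟨Or.inr ⟨rfl, rfl⟩, ?_, by dsimp only; omega⟩
    dsimp only
    cases hx : s i with
    | top => exact follows_top (ha.1 hx)
    | coe r =>
      rw [hx, follows_coe] at ha
      have := length_le_lcp hz (hsi r hx)
      cases hy : s j with
      | top => have := hb.1 hy; omega
      | coe t =>
        rw [hy, follows_coe] at hb
        have := le_and_lcp_of_lcp_lt (t := t) ha.1 (by omega)
        rw [follows_coe]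
        exact ⟨this.1, ha.2.trans this.2.symm⟩
  · cases hx : s i with
    | top =>
      cases hy : s j with
      | top =>
        simp [lcpCompare, hx, hy, charLoop_of_eq_top, follows_top (hb.1 hy), weight]
      | coe t =>
        have hlt : ¬ charAt (⊤ : WithTop (List α)) m ≤ charAt (t : WithTop (List α)) m := by
          rw [charAt_top, charAt_coe]
          exact not_le.2 (WithTop.coe_lt_top _)
        simp [lcpCompare, hx, hy, charLoop_of_eq_top, follows_top (ha.1 hx), weight, hlt]
        omega
    | coe r =>
      cases hy : s j with
      | top =>
        simp [lcpCompare, hx, hy, charLoop_of_eq_top, follows_top (hb.1 hy), weight, charAt_top]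
        omega
      | coe t =>
        rw [hx, follows_coe] at ha
        rw [hy, follows_coe] at hb
        have hle : m ≤ lcp r t := by
          have := min_lcp_le z r t
          omega
        by_cases hrt : r ≤ t
        · simp [lcpCompare, hx, hy, charLoop_coe r t m hle, charAt_lcp_le_iff, hrt, follows_coe,
            weight]
          omega
        · simp [lcpCompare, hx, hy, charLoop_coe r t m hle, charAt_lcp_le_iff, hrt, follows_coe,
            weight, le_of_not_ge hrt, lcp_comm t r]
          omega
  · rw [lcpCompare_of_gt _ hmn]
    refine ⟨Or.inl ⟨rfl, rfl⟩, ?_, by dsimp only; omega⟩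
    dsimp only
    cases hy : s j with
    | top => exact follows_top (hb.1 hy)
    | coe t =>
      rw [hy, follows_coe] at hb
      have := length_le_lcp hz (hsj t hy)
      cases hx : s i with
      | top => have := ha.1 hx; omega
      | coe r =>
        rw [hx, follows_coe] at ha
        have := le_and_lcp_of_lcp_lt (t := r) hb.1 (by omega)
        rw [follows_coe]
        exact ⟨this.1, hb.2.trans this.2.symm⟩

/-! ### Ancestors in a binary heap -/

/-- Heap node `y` lies in the subtree of heap node `x`, in the binary heap whose node `x`
has children `2 x` and `2 x + 1`. -/
def Below (x y : ℕ) : Prop := ∃ i, y / 2 ^ i = x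

theorem Below.refl (x : ℕ) : Below x x := ⟨0, by simp⟩

theorem Below.half {x y : ℕ} (h : Below x y) : Below (x / 2) y := by
  obtain ⟨i, rfl⟩ := h
  exact ⟨i + 1, by rw [pow_succ, Nat.div_div_eq_div_mul]⟩

theorem Below.of_left {x y : ℕ} (h : Below (2 * x) y) : Below x y := by
  simpa using h.half

theorem Below.of_right {x y : ℕ} (h : Below (2 * x + 1) y) : Below x y := by
  have h' := h.half
  rwa [show (2 * x + 1) / 2 = x by omega] at h'

theorem Below.le {x y : ℕ} (h : Below x y) : x ≤ y := by
  obtain ⟨i, rfl⟩ := h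
  exact Nat.div_le_self _ _

/-- Of two heap nodes above the same node, the lower one is below the other. -/
theorem Below.total {x x' y : ℕ} (h : Below x y) (h' : Below x' y) : Below x x' ∨ Below x' x := by
  obtain ⟨i, rfl⟩ := h
  obtain ⟨i', rfl⟩ := h'
  rcases le_total i i' with hi | hi
  · right
    exact ⟨i' - i, by rw [Nat.div_div_eq_div_mul, ← pow_add, Nat.add_sub_cancel' hi]⟩
  · left
    exact ⟨i - i', by rw [Nat.div_div_eq_div_mul, ← pow_add, Nat.add_sub_cancel' hi]⟩

theorem Below.eq_or_half {x y : ℕ} (h : Below x y) : x = y ∨ Below x (y / 2) := by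
  obtain ⟨i, rfl⟩ := h
  cases i with
  | zero => left; simp
  | succ i => right; exact ⟨i, by rw [Nat.div_div_eq_div_mul, pow_succ']⟩

theorem not_below_siblings {x y : ℕ} (hx : 0 < x) (h : Below (2 * x) y) :
    ¬ Below (2 * x + 1) y := by
  intro h'
  rcases h.total h' with h | h
  · rcases h.eq_or_half with h | h
    · omega
    · have := h.le
      omega
  · have := h.le
    omega

/-! ### Correctly played tournaments -/

/-- `Subtree b s t j x c A`: the tree `t` holds a correctly played tournament of the current strings
`s` below heap node `x`, which has height `j`. The winner is input `c`, and the losers stored in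
the game nodes have total weight `A`. The heap nodes are shifted by one against the nodes of `t`:
heap node `x` has children `2 x` and `2 x + 1`, its loser is stored in `t (x + 1)`, and input `k`
is the leaf `K + k`. -/
inductive Subtree {K : ℕ} (b : ℕ) (s : Fin K → WithTop (List α)) (t : Tree K) :
    ℕ → ℕ → Fin K → ℕ → Prop
  | leaf (k : Fin K) : Subtree b s t 0 (K + k) k 0
  | left {j x : ℕ} {c d : Fin K} {A B : ℕ} (hx : 0 < x) (hl : Subtree b s t j (2 * x) c A)
      (hr : Subtree b s t j (2 * x + 1) d B) (hd : (t (x + 1)).1 = d)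
      (hf : Follows b (s c) (s d) (t (x + 1)).2) :
      Subtree b s t (j + 1) x c (A + B + weight s (t (x + 1)))
  | right {j x : ℕ} {c d : Fin K} {A B : ℕ} (hx : 0 < x) (hl : Subtree b s t j (2 * x) d A)
      (hr : Subtree b s t j (2 * x + 1) c B) (hd : (t (x + 1)).1 = d)
      (hf : Follows b (s c) (s d) (t (x + 1)).2) :
      Subtree b s t (j + 1) x c (A + B + weight s (t (x + 1)))

namespace Subtree

variable {K b j x A : ℕ} {c : Fin K} {s s' : Fin K → WithTop (List α)} {t t' : Tree K}

theorem winner_below (h : Subtree b s t j x c A) : Below x (K + c) := by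
  induction h with
  | leaf k => exact Below.refl _
  | left _ _ _ _ _ ih _ => exact ih.of_left
  | right _ _ _ _ _ _ ih => exact ih.of_right

/-- A subtree is unaffected by changes to the tree and to the strings outside of it. -/
theorem congr (h : Subtree b s t j x c A) (ht : ∀ y, Below x y → t' (y + 1) = t (y + 1))
    (hs : ∀ k : Fin K, Below x (K + k) → s' k = s k) : Subtree b s' t' j x c A := by
  induction h with
  | leaf k => exact leaf k
  | @left j x c d A B hx hl hr hd hf ihl ihr =>
    have hc := hs c hl.winner_below.of_left
    have hd' := hs d hr.winner_below.of_right
    have htx := ht x (Below.refl x)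
    have := left (t := t') (s := s') hx
      (ihl (fun y hy => ht y hy.of_left) fun k hk => hs k hk.of_left)
      (ihr (fun y hy => ht y hy.of_right) fun k hk => hs k hk.of_right)
      (by rw [htx, hd]) (by rw [htx, hc, hd']; exact hf)
    rwa [htx, weight, hd, hd', ← hd, ← weight] at this
  | @right j x c d A B hx hl hr hd hf ihl ihr =>
    have hc := hs c hr.winner_below.of_right
    have hd' := hs d hl.winner_below.of_left
    have htx := ht x (Below.refl x)
    have := right (t := t') (s := s') hx
      (ihl (fun y hy => ht y hy.of_left) fun k hk => hs k hk.of_left)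
      (ihr (fun y hy => ht y hy.of_right) fun k hk => hs k hk.of_right)
      (by rw [htx, hd]) (by rw [htx, hc, hd']; exact hf)
    rwa [htx, weight, hd, hd', ← hd, ← weight] at this

/-- The winner of a subtree is minimal. At height `j`, the ancestor of a leaf is its quotient by
`2 ^ j`. -/
theorem le (h : Subtree b s t j x c A) (k : Fin K)
    (hk : (K + k) / 2 ^ j = x) : s c ≤ s k := by
  induction h with
  | leaf c =>
    have : k = c := by
      apply Fin.ext
      simpa using hk
    rw [this]
  | @left j x c d A B hx hl hr hd hf ihl ihr =>
    have h2 : (K + k) / 2 ^ j / 2 = x := by rw [Nat.div_div_eq_div_mul, ← pow_succ, hk]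
    rcases (by omega : (K + k) / 2 ^ j = 2 * x ∨ (K + k) / 2 ^ j = 2 * x + 1) with h3 | h3
    · exact ihl h3
    · exact hf.le.trans (ihr h3)
  | @right j x c d A B hx hl hr hd hf ihl ihr =>
    have h2 : (K + k) / 2 ^ j / 2 = x := by rw [Nat.div_div_eq_div_mul, ← pow_succ, hk]
    rcases (by omega : (K + k) / 2 ^ j = 2 * x ∨ (K + k) / 2 ^ j = 2 * x + 1) with h3 | h3
    · exact hf.le.trans (ihl h3)
    · exact ihr h3

theorem eq_zero (h : Subtree b s t j x c A) (hs : ∀ k, s k = ⊤) : A = 0 := by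
  induction h <;> simp_all [weight]

/-- Playing the game at heap node `x` between the winners `a` and `q` of its two subtrees,
in either order, both of which have reference string `z`. -/
theorem play {i A' B' : ℕ} {pre z : List α} {a q : Player K} {e d : Fin K}
    (hs : ∀ k (u : List α), s k = u → pre <+: u) (hz : pre <+: z) (hx : 0 < x)
    (hl : Subtree pre.length s t i (2 * x) e A') (hr : Subtree pre.length s t i (2 * x + 1) d B')
    (had : e = a.1 ∧ d = q.1 ∨ e = q.1 ∧ d = a.1)
    (ha : Follows pre.length z (s a.1) a.2) (hq : Follows pre.length z (s q.1) q.2) :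
    let g := lcpCompare s a q
    ∃ C, Subtree pre.length s (Function.update t (x + 1) g.loser) (i + 1) x g.winner.1 C ∧
      Follows pre.length z (s g.winner.1) g.winner.2 ∧
      g.cost + A' + B' + weight s a + weight s q ≤ C + weight s g.winner + 1 := by
  intro g
  obtain ⟨h1, h2, h3⟩ := lcpCompare_spec hs hz ha hq
  have hupd : ∀ y, Below (2 * x) y ∨ Below (2 * x + 1) y →
      Function.update t (x + 1) g.loser (y + 1) = t (y + 1) := by
    intro y hy
    apply Function.update_of_ne
    rcases hy with hy | hy <;> have := hy.le <;> omega
  have hl' := hl.congr (fun y hy => hupd y (Or.inl hy)) fun _ _ => rfl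
  have hr' := hr.congr (fun y hy => hupd y (Or.inr hy)) fun _ _ => rfl
  have hloser : Function.update t (x + 1) g.loser (x + 1) = g.loser := Function.update_self ..
  refine ⟨A' + B' + weight s g.loser, ?_, ?_, ?_⟩
  · have hw : g.winner.1 = e ∧ g.loser.1 = d ∨ g.winner.1 = d ∧ g.loser.1 = e := by
      rcases h1 with ⟨h1, h1'⟩ | ⟨h1, h1'⟩ <;> rcases had with ⟨rfl, rfl⟩ | ⟨rfl, rfl⟩ <;>
        simp [g, h1, h1']
    rcases hw with ⟨hw, hw'⟩ | ⟨hw, hw'⟩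
    · have := left hx hl' hr' (by rw [hloser, hw']) (by rw [hloser, ← hw, ← hw']; exact h2)
      rwa [hloser, ← hw] at this
    · have := right hx hl' hr' (by rw [hloser, hw']) (by rw [hloser, ← hw, ← hw']; exact h2)
      rwa [hloser, ← hw] at this
  · rcases h1 with ⟨h1, -⟩ | ⟨h1, -⟩ <;> simp only [g, h1] <;> assumption
  · simp only [g] at *; omega

end Subtree

/-! ### Replaying a path -/

/-- Replaying the path from the leaf of the winner `w` of a subtree, after `w` has been advanced, up
to the root `x` of the subtree. The losers on this path have lost to `w`, so the last string `z` of
`w` is their reference string as well as that of the new string of `w`. -/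
theorem replayPath_of_subtree {K j x A : ℕ} {w : Fin K} {s s' : Fin K → WithTop (List α)}
    {t : Tree K} {pre z : List α} {a : Player K} (h : Subtree pre.length s t j x w A)
    (hsw : s w = z) (hss : ∀ k, k ≠ w → s' k = s k)
    (hs : ∀ k (u : List α), s' k = u → pre <+: u) (hz : pre <+: z)
    (haw : a.1 = w) (ha : Follows pre.length z (s' a.1) a.2) (cnt : ℕ) :
    ∃ a' t' cnt' A', replayPath s' (K + w + 1) a t cnt = replayPath s' (x + 1) a' t' cnt' ∧
      Subtree pre.length s' t' j x a'.1 A' ∧ Follows pre.length z (s' a'.1) a'.2 ∧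
      cnt' + A + weight s' a ≤ cnt + A' + weight s' a' + j ∧
      ∀ y, ¬ Below x y → t' (y + 1) = t (y + 1) := by
  induction h with
  | leaf w =>
    subst haw
    exact ⟨a, t, cnt, 0, rfl, .leaf _, ha, le_rfl, fun _ _ => rfl⟩
  | @left j x c d A B hx hl hr hd hf ihl ihr =>
    obtain ⟨a', t', cnt', A', e1, e2, e3, e4, e5⟩ := ihl hsw hss haw
    have hdc : d ≠ c := by
      rintro rfl
      exact not_below_siblings hx hl.winner_below hr.winner_below
    have hx' : t' (x + 1) = t (x + 1) := e5 x fun hb => by have := hb.le; omega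
    have hr' : Subtree pre.length s' t' j (2 * x + 1) d B :=
      hr.congr (fun y hy => e5 y fun hb => not_below_siblings hx hb hy)
        fun k hk => hss k fun hkc => not_below_siblings hx hl.winner_below (hkc ▸ hk)
    have hq : Follows pre.length z (s' (t' (x + 1)).1) (t' (x + 1)).2 := by
      rw [hx', hd, hss d hdc, ← hsw]; exact hf
    obtain ⟨C, f1, f2, f3⟩ := Subtree.play hs hz hx e2 hr' (Or.inl ⟨rfl, by rw [hx', hd]⟩) e3 hq
    refine ⟨_, _, cnt' + (lcpCompare s' a' (t' (x + 1))).cost, C, ?_, f1, f2, ?_, ?_⟩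
    · rw [e1, replayPath, dif_pos (by omega), show (2 * x + 1 + 1) / 2 = x + 1 by omega]
    · have : weight s' (t' (x + 1)) = weight s (t (x + 1)) := by
        rw [hx', weight, weight, hd, hss d hdc]
      omega
    · intro y hy
      rw [Function.update_of_ne, e5 y fun hb => hy hb.of_left]
      intro hxy
      exact hy (by rw [Nat.add_right_cancel hxy]; exact Below.refl x)
  | @right j x c d A B hx hl hr hd hf ihl ihr =>
    obtain ⟨a', t', cnt', A', e1, e2, e3, e4, e5⟩ := ihr hsw hss haw
    have hdc : d ≠ c := by
      rintro rfl
      exact not_below_siblings hx hl.winner_below hr.winner_below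
    have hx' : t' (x + 1) = t (x + 1) := e5 x fun hb => by have := hb.le; omega
    have hl' : Subtree pre.length s' t' j (2 * x) d A :=
      hl.congr (fun y hy => e5 y fun hb => not_below_siblings hx hy hb)
        fun k hk => hss k fun hkc => not_below_siblings hx (hkc ▸ hk) hr.winner_below
    have hq : Follows pre.length z (s' (t' (x + 1)).1) (t' (x + 1)).2 := by
      rw [hx', hd, hss d hdc, ← hsw]; exact hf
    obtain ⟨C, f1, f2, f3⟩ := Subtree.play hs hz hx hl' e2 (Or.inr ⟨by rw [hx', hd], rfl⟩) e3 hq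
    refine ⟨_, _, cnt' + (lcpCompare s' a' (t' (x + 1))).cost, C, ?_, f1, f2, ?_, ?_⟩
    · rw [e1, replayPath, dif_pos (by omega), show (2 * x + 1 + 1 + 1) / 2 = x + 1 by omega]
    · have : weight s' (t' (x + 1)) = weight s (t (x + 1)) := by
        rw [hx', weight, weight, hd, hss d hdc]
      omega
    · intro y hy
      rw [Function.update_of_ne, e5 y fun hb => hy hb.of_right]
      intro hxy
      exact hy (by rw [Nat.add_right_cancel hxy]; exact Below.refl x)

/-! ### Building the tree -/

/-- The inputs whose leaves lie below heap node `x` of height `j`, from left to right. -/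
def leaves (K : ℕ) : ℕ → ℕ → List (Fin K)
  | 0, x => if h : x - K < K then [⟨x - K, h⟩] else []
  | j + 1, x => leaves K j (2 * x) ++ leaves K j (2 * x + 1)

theorem map_val_leaves {K j x : ℕ} (h1 : K ≤ x * 2 ^ j) (h2 : (x + 1) * 2 ^ j ≤ 2 * K) :
    (leaves K j x).map Fin.val = List.range' (x * 2 ^ j - K) (2 ^ j) := by
  induction j generalizing x with
  | zero => rw [leaves, dif_pos (by omega)]; simp
  | succ j ih =>
    rw [pow_succ] at h1 h2
    have h3 : 0 < 2 ^ j := by positivity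
    rw [leaves, List.map_append, ih (by linarith) (by linarith), ih (by linarith) (by linarith),
      show 2 * x * 2 ^ j = x * 2 ^ (j + 1) by ring,
      show (2 * x + 1) * 2 ^ j - K = x * 2 ^ (j + 1) - K + 2 ^ j by
        rw [show (2 * x + 1) * 2 ^ j = x * 2 ^ (j + 1) + 2 ^ j by ring, Nat.sub_add_comm]
        rwa [pow_succ],
      List.range'_append_1, pow_succ, mul_two]

theorem leaves_eq_finRange (m : ℕ) : leaves (2 ^ m) m 1 = List.finRange (2 ^ m) := by
  apply List.map_injective_iff.2 Fin.val_injective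
  rw [map_val_leaves (by omega) (by omega), List.map_coe_finRange_eq_range, List.range_eq_range']
  simp

/-- Building the tree below heap node `x` of height `j`: the inputs of that subtree have been
entered, and the winner `a` is about to be passed on to the parent of `x`. As long as nothing has
been output, the common prefix `pre` serves as reference string of all players. -/
theorem foldl_buildPath {K : ℕ} {s : Fin K → WithTop (List α)} {pre : List α}
    (hs : ∀ k (u : List α), s k = u → pre <+: u) (j x : ℕ) (hx : 0 < x)
    (h1 : K ≤ x * 2 ^ j) (h2 : (x + 1) * 2 ^ j ≤ 2 * K) (t : Tree K) (cnt : ℕ) :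
    ∃ a t' cnt' A, (leaves K j x).foldl (fun (r : Tree K × ℕ) k =>
        buildPath s (K + (k.val + 1)) (k, pre.length) r.1 r.2) (t, cnt) =
          buildPath s (x + 1) a t' cnt' ∧
      Subtree pre.length s t' j x a.1 A ∧ Follows pre.length pre (s a.1) a.2 ∧
      cnt' + ((leaves K j x).map fun k => weight s (k, pre.length)).sum + 1 ≤
        cnt + A + weight s a + 2 ^ j ∧
      ∀ y, ¬ Below x y → t' (y + 1) = t (y + 1) := by
  induction j generalizing x t cnt with
  | zero =>
    have hxK : x - K < K := by omega
    obtain ⟨k, hk⟩ : ∃ k : Fin K, x = K + k := ⟨⟨x - K, hxK⟩, by simp; omega⟩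
    have hl : leaves K 0 x = [k] := by
      rw [leaves, dif_pos hxK]
      congr 1
      apply Fin.ext
      simp [hk]
    subst hk
    refine ⟨(k, pre.length), t, cnt, 0, ?_, .leaf _, ?_, ?_, fun _ _ => rfl⟩
    · rw [hl]; rfl
    · cases hk : s k with
      | top => exact follows_top le_rfl
      | coe u =>
        have := hs k u hk
        exact follows_coe.2 ⟨le_of_prefix this, (lcp_of_prefix this).symm⟩
    · simp [hl]
  | succ j ih =>
    rw [pow_succ] at h1 h2
    have h3 : 0 < 2 ^ j := by positivity
    obtain ⟨a, t₁, cnt₁, A, e1, e2, e3, e4, e5⟩ :=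
      ih (2 * x) (by omega) (by linarith) (by linarith) t cnt
    -- A left child leaves its winner in the parent, where its right sibling finds it as opponent.
    have hstore : buildPath s (2 * x + 1) a t₁ cnt₁ = (Function.update t₁ (x + 1) a, cnt₁) := by
      rw [buildPath, dif_neg (by omega), show (2 * x + 1 + 1) / 2 = x + 1 by omega]
    obtain ⟨q, t₂, cnt₂, B, f1, f2, f3, f4, f5⟩ :=
      ih (2 * x + 1) (by omega) (by linarith) (by linarith) (Function.update t₁ (x + 1) a) cnt₁
    have hx2 : t₂ (x + 1) = a := by
      rw [f5 x fun hb => by have := hb.le; omega, Function.update_self]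
    have hl : Subtree pre.length s t₂ j (2 * x) a.1 A := by
      refine e2.congr (fun y hy => ?_) fun _ _ => rfl
      rw [f5 y fun hb => not_below_siblings hx hy hb, Function.update_of_ne]
      have := hy.le
      omega
    obtain ⟨C, g1, g2, g3⟩ := Subtree.play (a := q) (q := a) hs (List.prefix_refl pre) hx hl f2
      (Or.inr ⟨rfl, rfl⟩) f3 e3
    refine ⟨_, _, cnt₂ + (lcpCompare s q a).cost, C, ?_, g1, g2, ?_, ?_⟩
    · rw [leaves, List.foldl_append, e1, hstore, f1, buildPath, dif_pos (by omega),
        show (2 * x + 1 + 1) / 2 = x + 1 by omega, hx2]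
    · rw [leaves, List.map_append, List.sum_append, pow_succ]
      omega
    · intro y hy
      have hne : y + 1 ≠ x + 1 := by
        intro hxy
        exact hy (by rw [Nat.add_right_cancel hxy]; exact Below.refl x)
      rw [Function.update_of_ne hne, f5 y fun hb => hy hb.of_right, Function.update_of_ne hne,
        e5 y fun hb => hy hb.of_left]

/-! ### The invariant of the merge -/

theorem replayPath_top {K : ℕ} (s : Fin K → WithTop (List α)) (a : Player K) (t : Tree K)
    (cnt : ℕ) : replayPath s (1 + 1) a t cnt = (Function.update t 1 a, cnt) := by
  rw [replayPath, dif_neg (by omega)]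

theorem buildPath_top {K : ℕ} (s : Fin K → WithTop (List α)) (a : Player K) (t : Tree K)
    (cnt : ℕ) : buildPath s (1 + 1) a t cnt = (Function.update t 1 a, cnt) := by
  rw [buildPath, dif_neg (by omega)]

theorem Subtree.update_top {K b j A : ℕ} {c : Fin K} {s : Fin K → WithTop (List α)} {t : Tree K}
    (h : Subtree b s t j 1 c A) (a : Player K) : Subtree b s (Function.update t 1 a) j 1 c A := by
  refine h.congr (fun y hy => Function.update_of_ne ?_ ..) fun _ _ => rfl
  have := hy.le
  omega

theorem front_eq_coe {α : Type*} {K : ℕ} {S : Fin K → List (List α)} {i : Fin K → ℕ} {k : Fin K}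
    (h : i k < (S k).length) : front S i k = (((S k)[i k] : List α) : WithTop (List α)) := by
  rw [front, List.getElem?_eq_getElem h]
  rfl

theorem front_eq_top {α : Type*} {K : ℕ} {S : Fin K → List (List α)} {i : Fin K → ℕ} {k : Fin K}
    (h : (S k).length ≤ i k) : front S i k = ⊤ := by
  rw [front, List.getElem?_eq_none h]
  rfl

theorem mem_of_front {α : Type*} {K : ℕ} {S : Fin K → List (List α)} {i : Fin K → ℕ} {k : Fin K}
    {u : List α} (h : front S i k = u) : u ∈ S k :=
  List.mem_of_getElem? (i := i k) h

/-- The state of the merge after the strings of `T` have been output. The last output string `z`, or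
the common prefix `p` of all strings if there is none, is the reference string of the overall
winner, and `A` is the total weight of the losers. The output LCP values are the LCP lengths of
neighbours in `p :: T`, so that the first one is `p.length`.

`balance` accounts for the character comparisons. The final comparison of a game is counted by
the number of games, `2 ^ m - 1` while building and `m` in each round; every other one increases the
total weight of the tree by one. Weight enters the tree with the initial players and with the items
of the inputs, and leaves it with the output. -/
structure Invariant {m : ℕ} (S : Fin (2 ^ m) → List (List α)) (H : Fin (2 ^ m) → List ℕ)
    (p : List α) (T : List (List α)) (z : List α) (A : ℕ) (st : State α (2 ^ m)) : Prop where
  outS_eq : st.outS = T.map WithTop.some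
  outH_eq : st.outH = List.zipWith lcp (p :: T) T
  last : (p :: T).getLast? = some z
  sorted : (p :: T).IsChain (· ≤ ·)
  idx_le : ∀ k, st.idx k ≤ (S k).length
  perm : (T : Multiset (List α)) + ∑ k, ((S k).drop (st.idx k) : Multiset (List α)) =
    ∑ k, (S k : Multiset (List α))
  subtree : Subtree p.length (front S st.idx) st.tree m 1 (st.tree 1).1 A
  follows : Follows p.length z (front S st.idx (st.tree 1).1) (st.tree 1).2
  balance : st.cmps + (∑ k, weight (front S fun _ => 0) (k, p.length)) + 1 +
      ∑ k, ((H k).drop 1).sum ≤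
    st.outH.sum + A + weight (front S st.idx) (st.tree 1) + 2 ^ m + T.length * m +
      ∑ k, ((H k).drop (st.idx k + 1)).sum

variable {m : ℕ} {S : Fin (2 ^ m) → List (List α)} {H : Fin (2 ^ m) → List ℕ} {p : List α}

theorem invariant_build (hp : ∀ k, ∀ s ∈ S k, p <+: s) :
    ∃ A, Invariant S H p [] p A (build S p.length) := by
  obtain ⟨a, t, cnt, A, h1, h2, h3, h4, -⟩ := foldl_buildPath (K := 2 ^ m)
    (s := front S fun _ => 0) (pre := p) (fun k u h => hp k u (mem_of_front h)) m 1 one_pos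
    (by omega) (by omega) (fun _ => (0, 0)) 0
  rw [leaves_eq_finRange, buildPath_top] at h1
  rw [leaves_eq_finRange, ← List.ofFn_eq_map, List.sum_ofFn] at h4
  have hb : build S p.length = ⟨fun _ => 0, Function.update t 1 a, [], [], cnt⟩ := by
    rw [build, h1]
  refine ⟨A, ?_⟩
  rw [hb]
  constructor <;> try simp only [Function.update_self]
  · rfl
  · rfl
  · rfl
  · exact List.isChain_singleton p
  · exact fun _ => Nat.zero_le _
  · simp
  · exact h2.update_top a
  · exact h3
  · simp only [List.sum_nil, List.length_nil, zero_add]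
    omega

theorem sum_apply_eq_add_sum_apply_update {ι M : Type*} [Fintype ι] [DecidableEq ι]
    [AddCommMonoid M] (f : ι → ℕ → M) (i : ι → ℕ) (w : ι) (v : ℕ) (x : M)
    (h : f w (i w) = x + f w v) :
    ∑ k, f k (i k) = x + ∑ k, f k (Function.update i w v k) := by
  rw [← Finset.add_sum_erase _ _ (Finset.mem_univ w), ← Finset.add_sum_erase (a := w) _
    (fun k => f k (Function.update i w v k)) (Finset.mem_univ w), h,
    Function.update_self, add_assoc]
  congr 2
  refine Finset.sum_congr rfl fun k hk => ?_
  rw [Function.update_of_ne (Finset.ne_of_mem_erase hk)]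

theorem sum_drop_eq (l : List ℕ) (i : ℕ) :
    (l.drop i).sum = l.getD i 0 + (l.drop (i + 1)).sum := by
  by_cases h : i < l.length
  · rw [List.drop_eq_getElem_cons h, List.sum_cons, List.getD_eq_getElem _ _ h]
  · rw [List.drop_eq_nil_of_le (by omega), List.drop_eq_nil_of_le (by omega),
      List.getD_eq_default _ _ (by omega)]
    rfl

theorem zipWith_cons_append_singleton {β γ : Type*} {f : β → β → γ} {x z : β} {l : List β}
    (h : (x :: l).getLast? = some z) (y : β) :
    List.zipWith f (x :: (l ++ [y])) (l ++ [y]) = List.zipWith f (x :: l) l ++ [f z y] := by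
  induction l generalizing x with
  | nil => simp_all
  | cons a l ih => simpa using ih (x := a) (by simpa using h)

/-- One round preserves the invariant, as long as there are strings left. -/
theorem invariant_step (hS : ∀ k, (S k).Pairwise (· ≤ ·)) (hH : ∀ k, IsLCPArray (S k) (H k))
    (hp : ∀ k, ∀ s ∈ S k, p <+: s) {T : List (List α)} {z : List α} {A : ℕ}
    {st : State α (2 ^ m)} (h : Invariant S H p T z A st) (hT : T.length < ∑ k, (S k).length) :
    ∃ z' A', Invariant S H p (T ++ [z']) z' A' (step S H st) := by
  have hz : p <+: z := by
    rcases List.mem_cons.1 (List.mem_of_getLast? h.last) with rfl | hzT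
    · exact List.prefix_refl _
    · have : z ∈ ∑ k, (S k : Multiset (List α)) := by
        rw [← h.perm]
        exact Multiset.mem_add.2 (Or.inl hzT)
      obtain ⟨k, -, hk⟩ := Multiset.mem_sum.1 this
      exact hp k z hk
  generalize hw : (st.tree 1).1 = w
  have hsub := h.subtree
  have hfol := h.follows
  rw [hw] at hsub hfol
  -- The winner is minimal, so it is a sentinel only if all inputs are exhausted.
  have hlen : st.idx w < (S w).length := by
    by_contra hge
    have htop : front S st.idx w = ⊤ := front_eq_top (not_lt.1 hge)
    have hall : ∀ k, (S k).length ≤ st.idx k := by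
      intro k
      by_contra hk
      have hle := hsub.le k (by
        rw [Nat.add_div_left _ (by positivity), Nat.div_eq_of_lt k.2])
      rw [htop, front_eq_coe (not_le.1 hk)] at hle
      exact absurd hle (not_le.2 (WithTop.coe_lt_top _))
    have hcard := congrArg Multiset.card h.perm
    simp only [Multiset.card_add, Multiset.card_sum, Multiset.coe_card, List.length_drop] at hcard
    rw [Finset.sum_eq_zero (f := fun k => (S k).length - st.idx k)
      fun k _ => Nat.sub_eq_zero_of_le (hall k)] at hcard
    omega
  generalize hu : (S w)[st.idx w] = u
  have hfw : front S st.idx w = u := by rw [front_eq_coe hlen, hu]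
  rw [hfw, follows_coe] at hfol
  have hpu : p <+: u := hp w u (mem_of_front hfw)
  set i' := Function.update st.idx w (st.idx w + 1) with hi'
  have hi'w : i' w = st.idx w + 1 := Function.update_self ..
  have hss : ∀ k, k ≠ w → front S i' k = front S st.idx k := by
    intro k hk
    rw [front, front, hi', Function.update_of_ne hk]
  have hnew : Follows p.length u (front S i' w) ((H w).getD (i' w) 0) := by
    by_cases hlt : i' w < (S w).length
    · have hltH : i' w < (H w).length := by rw [(hH w).1]; exact hlt
      rw [front_eq_coe hlt, follows_coe, List.getD_eq_getElem _ _ hltH]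
      simp only [hi'w] at hlt hltH ⊢
      rw [← hu]
      exact ⟨List.pairwise_iff_getElem.1 (hS w) _ _ _ _ (Nat.lt_succ_self _), (hH w).2 _ hlt hltH⟩
    · rw [front_eq_top (not_lt.1 hlt),
        List.getD_eq_default _ _ (by rw [(hH w).1]; exact not_lt.1 hlt)]
      exact follows_top (Nat.zero_le _)
  obtain ⟨a, t, cnt, B, h1, h2, h3, h4, -⟩ := replayPath_of_subtree hsub hfw hss
    (fun k v hv => hp k v (mem_of_front hv)) hpu (a := (w, (H w).getD (i' w) 0)) rfl hnew st.cmps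
  rw [replayPath_top] at h1
  have hst : step S H st = ⟨i', Function.update t 1 a, st.outS ++ [(u : WithTop (List α))],
      st.outH ++ [(st.tree 1).2], cnt⟩ := by
    simp only [step, hw, ← hi', hfw, ← add_assoc, h1]
  refine ⟨u, B, ?_⟩
  rw [hst]
  constructor <;> try simp only [Function.update_self]
  · rw [h.outS_eq, List.map_append]
    rfl
  · rw [h.outH_eq, hfol.2, zipWith_cons_append_singleton h.last]
  · rw [← List.cons_append, List.getLast?_concat]
  · rw [← List.cons_append, List.isChain_append]
    refine ⟨h.sorted, List.isChain_singleton u, ?_⟩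
    intro x hx y hy
    rw [h.last] at hx
    obtain rfl := Option.mem_some_iff.1 hx
    obtain rfl := Option.mem_some_iff.1 hy
    exact hfol.1
  · intro k
    by_cases hk : k = w
    · rw [hk, hi'w]; exact hlen
    · rw [hi', Function.update_of_ne hk]; exact h.idx_le k
  · rw [← h.perm, sum_apply_eq_add_sum_apply_update
      (fun k j => ((S k).drop j : Multiset (List α))) st.idx w
      (st.idx w + 1) {u} (by rw [List.drop_eq_getElem_cons hlen, hu]; rfl), ← add_assoc]
    rfl
  · exact h2.update_top a
  · exact h3
  · have hbal := h.balance
    rw [sum_apply_eq_add_sum_apply_update (fun k j => ((H k).drop (j + 1)).sum) st.idx w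
      (st.idx w + 1) ((H w).getD (i' w) 0) (by rw [hi'w]; exact sum_drop_eq _ _), ← hi'] at hbal
    have hw1 : weight (front S st.idx) (st.tree 1) = (st.tree 1).2 := by
      simp [weight, hw, hfw]
    have hw2 : weight (front S i') (w, (H w).getD (i' w) 0) = (H w).getD (i' w) 0 := by
      rw [weight]
      split_ifs with htop
      · by_contra hne
        have hlt : i' w < (S w).length := by
          rw [← (hH w).1]
          by_contra hge
          exact hne (List.getD_eq_default _ _ (not_lt.1 hge)).symm
        rw [front_eq_coe hlt] at htop
        exact WithTop.coe_ne_top htop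
      · rfl
    rw [hw1] at hbal
    rw [hw2] at h4
    simp only [List.sum_append, List.length_append, List.sum_singleton, List.length_singleton,
      add_mul, one_mul]
    omega

theorem exists_invariant (hS : ∀ k, (S k).Pairwise (· ≤ ·)) (hH : ∀ k, IsLCPArray (S k) (H k))
    (hp : ∀ k, ∀ s ∈ S k, p <+: s) (r : ℕ) (hr : r ≤ ∑ k, (S k).length) :
    ∃ T z A, T.length = r ∧ Invariant S H p T z A ((step S H)^[r] (build S p.length)) := by
  induction r with
  | zero =>
    obtain ⟨A, h⟩ := invariant_build (H := H) hp
    exact ⟨[], p, A, rfl, h⟩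
  | succ r ih =>
    obtain ⟨T, z, A, rfl, h⟩ := ih (by omega)
    obtain ⟨z', A', h'⟩ := invariant_step hS hH hp h hr
    refine ⟨T ++ [z'], z', A', by simp, ?_⟩
    rwa [Function.iterate_succ_apply']

/-! ### The output -/

theorem isLCPArray_zipWith (p : List α) (T : List (List α)) :
    IsLCPArray T (List.zipWith lcp (p :: T) T) := by
  refine ⟨by simp, fun i hT hH => ?_⟩
  simp

theorem coe_flatten_ofFn {β : Type*} {K : ℕ} (S : Fin K → List β) :
    ((List.ofFn S).flatten : Multiset β) = ∑ k, (S k : Multiset β) := by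
  induction K with
  | zero => simp
  | succ K ih =>
    rw [List.ofFn_succ, List.flatten_cons, Fin.sum_univ_succ, ← ih, Multiset.coe_add]

end KWayLCP

theorem mainTheorem2 {α : Type*} [LinearOrder α] {K : ℕ} [NeZero K] (hK : ∃ m : ℕ, K = 2 ^ m)
    (S : Fin K → List (List α)) (H : Fin K → List ℕ)
    (hS : ∀ k, (S k).Pairwise (· ≤ ·)) (hH : ∀ k, KWayLCP.IsLCPArray (S k) (H k))
    (p : List α) (hp : ∀ k, ∀ s ∈ S k, p <+: s) :
    ∃ S₀ : List (List α),
      (KWayLCP.kwayMerge S H p.length).outS = S₀.map WithTop.some ∧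
      S₀.Perm (List.ofFn S).flatten ∧ S₀.Pairwise (· ≤ ·) ∧
      KWayLCP.IsLCPArray S₀ (KWayLCP.kwayMerge S H p.length).outH ∧
      ((KWayLCP.kwayMerge S H p.length).cmps : ℝ) ≤
        ((KWayLCP.lcpSum (KWayLCP.kwayMerge S H p.length).outH : ℝ)
            - ∑ k, (KWayLCP.lcpSum (H k) : ℝ))
          + (S₀.length : ℝ) * Real.logb 2 (K : ℝ) + (K : ℝ) := by
  obtain ⟨m, rfl⟩ := hK
  obtain ⟨T, z, A, hT, h⟩ := KWayLCP.exists_invariant hS hH hp _ le_rfl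
  have hcard := congrArg Multiset.card h.perm
  have hidx := h.idx_le
  have hperm := h.perm
  have hsub := h.subtree
  have hbal := h.balance
  have houtH := h.outH_eq
  rw [← KWayLCP.kwayMerge] at h hidx hperm hsub hbal hcard houtH
  generalize hst : KWayLCP.kwayMerge S H p.length = st at *
  simp only [Multiset.card_add, Multiset.card_sum, Multiset.coe_card, List.length_drop, hT,
    Nat.add_eq_left, Finset.sum_eq_zero_iff, Finset.mem_univ, true_imp_iff] at hcard
  have hlen : ∀ k, (S k).length ≤ st.idx k := fun k => Nat.sub_eq_zero_iff_le.1 (hcard k)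
  have htop : ∀ k, KWayLCP.front S st.idx k = ⊤ := fun k => KWayLCP.front_eq_top (hlen k)
  refine ⟨T, h.outS_eq, ?_, ?_, ?_, ?_⟩
  · rw [← Multiset.coe_eq_coe, KWayLCP.coe_flatten_ofFn, ← hperm,
      Finset.sum_eq_zero fun k _ => by rw [List.drop_eq_nil_of_le (hlen k)]; rfl, add_zero]
  · exact (List.isChain_iff_pairwise.1 h.sorted).of_cons
  · rw [houtH]
    exact KWayLCP.isLCPArray_zipWith p T
  -- In the end all players are sentinels, so no weight is left in the tree.
  · rw [hsub.eq_zero htop, KWayLCP.weight, if_pos (htop _), Finset.sum_eq_zero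
      (f := fun k => ((H k).drop (st.idx k + 1)).sum) fun k _ => by
        rw [List.drop_eq_nil_of_le (by rw [(hH k).1]; exact (hlen k).trans (Nat.le_succ _))]
        rfl] at hbal
    -- The first output LCP value is not part of `lcpSum`. It is `p.length`, which is covered by the
    -- initial weight of any nonempty input.
    have hfirst : st.outH.sum ≤ KWayLCP.lcpSum st.outH +
        ∑ k, KWayLCP.weight (KWayLCP.front S fun _ => 0) (k, p.length) := by
      rw [houtH]
      cases T with
      | nil => simp
      | cons u T =>
        have hu : u ∈ ∑ k, (S k : Multiset (List α)) := by
          rw [← hperm]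
          simp
        obtain ⟨k, -, hk⟩ := Multiset.mem_sum.1 hu
        have hk0 : 0 < (S k).length := List.length_pos_of_mem hk
        have hweight : KWayLCP.weight (KWayLCP.front S fun _ => 0) (k, p.length) = p.length := by
          rw [KWayLCP.weight, KWayLCP.front_eq_coe hk0, if_neg WithTop.coe_ne_top]
        have hle := Finset.single_le_sum (f := fun k =>
          KWayLCP.weight (KWayLCP.front S fun _ => 0) (k, p.length))
          (fun _ _ => Nat.zero_le _) (Finset.mem_univ k)
        simp only [hweight] at hle
        simp only [List.zipWith_cons_cons, List.sum_cons, KWayLCP.lcpSum, List.tail_cons,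
          KWayLCP.lcp_of_prefix (hp k u hk)]
        omega
    have hfinal : st.cmps + ∑ k, KWayLCP.lcpSum (H k) ≤
        KWayLCP.lcpSum st.outH + T.length * m + 2 ^ m := by
      simp only [KWayLCP.lcpSum, ← List.drop_one] at hfirst ⊢
      omega
    have hlog : Real.logb 2 ((2 ^ m : ℕ) : ℝ) = m := by
      rw [Nat.cast_pow, Nat.cast_ofNat, Real.logb_pow, Real.logb_self_eq_one (by norm_num), mul_one]
    rw [hlog]
    have hreal : ((st.cmps + ∑ k, KWayLCP.lcpSum (H k) : ℕ) : ℝ) ≤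
        ((KWayLCP.lcpSum st.outH + T.length * m + 2 ^ m : ℕ) : ℝ) := Nat.cast_le.2 hfinal
    push_cast at hreal ⊢
    linarith
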